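/- Let $\alpha,\beta\in\mathbb{R}$ satisfy $\alpha>-\tfrac12$ and $-\tfrac12<\beta<\tfrac12$, or $\beta>-\tfrac12$ and $-\tfrac12<\alpha<\tfrac12$, and let $b\ge 0$ and $c\in\mathbb{R}$. For $|\arg z|<\pi$ let $W_{\kappa,\mu}(z)$ be the (principal branch of the) Whittaker function, which for $\operatorname{Re}(\tfrac12+\mu-\kappa)>0$ is $$W_{\kappa,\mu}(z)=\frac{e^{-z/2}z^{\kappa}}{\Gamma(\frac12+\mu-\kappa)}\int_0^\infty e^{-t}\,t^{\mu-\kappa-\frac12}\Bigl(1+\frac tz\Bigr)^{\mu+\kappa-\frac12}dt ,$$ with principal values of all powers. Consider, in $\mathbb{C}\setminus(-\infty,0]$, the equation $$z^{\frac{\alpha+\beta}{2}-1}\,e^{z/2}\,W_{-\frac{\alpha+\beta}{2},\,\frac{\beta-\alpha}{2}}(z)-bz-c=0 .$$ If $b>0$, or if $b=0$ and $c>0$, then the equation has exactly one solution in $\mathbb{C}\setminus(-\infty,0]$, and this solution is real and positive. Otherwise (that is, if $b=0$ and $c\le 0$) it has no solution in $\mathbb{C}\setminus(-\infty,0]$.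 Moreover, $W_{-\frac{\alpha+\beta}{2},\,\frac{\beta-\alpha}{2}}(z)\neq 0$ for every $z\in\mathbb{C}\setminus(-\infty,0]$. -/

import Mathlib

/-- The Whittaker function `W_{κ,μ}(z)` on the plane cut along `(-∞, 0]`, given by Whittaker's integral
`W_{κ,μ}(z) = e^{-z/2} z^κ / Γ(1/2 + μ - κ) * ∫_0^∞ e^{-t} t^{μ-κ-1/2} (1 + t/z)^{μ+κ-1/2} dt`.
This is the definition of `W_{κ,μ}` for `Re (1/2 + μ - κ) > 0` and `|arg z| < π` (the integral converges
absolutely there, and `1 + t/z` stays in the cut plane); all powers are principal values. It is the solution of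
`w'' = (1/4 - κ/z + (μ² - 1/4)/z²) w` with `w ~ e^{-z/2} z^κ` at infinity, that is
`W_{κ,μ}(z) = e^{-z/2} z^{1/2+μ} U(1/2+μ-κ, 1+2μ, z)`. Outside this range of `κ, μ` and `z` the value
is not meaningful. -/
noncomputable def whittakerW (κ μ z : ℂ) : ℂ :=
  Complex.exp (-z / 2) * z ^ κ / Complex.Gamma (1 / 2 + μ - κ) *
    ∫ t in Set.Ioi (0 : ℝ),
      Complex.exp (-(t : ℂ)) * (t : ℂ) ^ (μ - κ - 1 / 2) * (1 + (t : ℂ) / z) ^ (μ + κ - 1 / 2)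

/-- The solutions of `z^{(α+β)/2-1} e^{z/2} W_{-(α+β)/2,(β-α)/2}(z) - b z - c = 0` in the plane cut
along `(-∞, 0]`. -/
def whittakerSolutions (α β b c : ℝ) : Set ℂ :=
  {z : ℂ | z ∈ Complex.slitPlane ∧
    z ^ (((α : ℂ) + (β : ℂ)) / 2 - 1) * Complex.exp (z / 2) *
        whittakerW (-((α : ℂ) + (β : ℂ)) / 2) (((β : ℂ) - (α : ℂ)) / 2) z
      - (b : ℂ) * z - (c : ℂ) = 0}

/-! The exponential and the powers cancel, turning the equation into `z⁻¹ * N z = b * z + c`. Here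
`N` is the average of `(1 + t/z)^(-A)` over a Gamma density of parameter `B`, with `A = α + 1/2` and
`B = β + 1/2`.

If `0 < A < 1`, the function `z⁻¹ * N z` maps the upper half-plane into the lower one and conversely
(`inv_mul_tricomiN_im_neg`, `inv_mul_tricomiN_im_pos`), whereas `b * z + c` with `b ≥ 0` never
reverses the sign of the imaginary part. Hence every solution is real and positive. On the positive
axis `x⁻¹ * N x` decreases strictly from `+∞` to `0`, so it meets the nondecreasing line once or
never. A zero of `W` would be a solution with `b = c = 0`.

Kummer's symmetry, exchanging `A` and `B` (`tricomiN_symm`), covers the case where only `B` is known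
to lie in `(0, 1)`. -/

open MeasureTheory in
theorem integrableOn_gammaWeight {b : ℝ} (hb : 0 < b) :
    IntegrableOn (fun t : ℝ => Real.exp (-t) * t ^ (b - 1)) (Set.Ioi 0) volume :=
  Real.GammaIntegral_convergent hb

/-- Tricomi's function in the normalization `z ^ a * U(a, 1 + a - b, z)`, given by its Laplace
integral. -/
noncomputable def tricomiN (a b : ℝ) (z : ℂ) : ℂ :=
  (∫ t in Set.Ioi (0 : ℝ), ((Real.exp (-t) * t ^ (b - 1) : ℝ) : ℂ) *
    (1 + (t : ℂ) / z) ^ (((-a : ℝ)) : ℂ)) / (Real.Gamma b : ℂ)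

/-! ### Holomorphy on the cut plane -/

theorem one_add_div_mem_slitPlane {z : ℂ} (hz : z ∈ Complex.slitPlane) {t : ℝ} (ht : 0 ≤ t) :
    1 + (t : ℂ) / z ∈ Complex.slitPlane := by
  rcases ht.eq_or_lt with rfl | ht
  · simp
  have hn : 0 < Complex.normSq z := Complex.normSq_pos.2 (Complex.slitPlane_ne_zero hz)
  rw [Complex.mem_slitPlane_iff] at hz ⊢
  rw [div_eq_mul_inv]
  simp only [Complex.add_re, Complex.one_re, Complex.re_ofReal_mul, Complex.add_im,
    Complex.one_im, Complex.im_ofReal_mul, zero_add, Complex.inv_re, Complex.inv_im]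
  rcases hz with h | h
  · left; positivity
  · right; exact mul_ne_zero ht.ne' (div_ne_zero (neg_ne_zero.2 h) hn.ne')

/-- Uniform lower bounds for `z` and `1 + t / z` near a point of the cut plane. -/
theorem exists_ball_bounds {z₀ : ℂ} (hz : z₀ ∈ Complex.slitPlane) :
    ∃ r > 0, ∃ δ > 0, ∀ z ∈ Metric.ball z₀ r, z ∈ Complex.slitPlane ∧ r ≤ ‖z‖ ∧
      ∀ t : ℝ, 0 ≤ t → δ ≤ ‖1 + (t : ℂ) / z‖ := by
  obtain ⟨R, hR, hball⟩ := Metric.isOpen_iff.1 Complex.isOpen_slitPlane z₀ hz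
  have hr : 0 < R / 2 := by positivity
  refine ⟨R / 2, hr, (R / 2) / (‖z₀‖ + R / 2), by positivity, fun z hzb => ?_⟩
  have hzs : z ∈ Complex.slitPlane := hball (Metric.ball_subset_ball (by linarith) hzb)
  rw [Metric.mem_ball, dist_eq_norm] at hzb
  -- The point `-t` lies on the cut, hence at distance at least `R` from `z₀`, while `z` is within
  -- `R / 2` of `z₀`.
  have key : ∀ t : ℝ, 0 ≤ t → R / 2 ≤ ‖z + t‖ := by
    intro t ht
    by_contra! hlt
    have hmem : (-(t : ℂ)) ∈ Metric.ball z₀ R := by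
      rw [Metric.mem_ball, dist_eq_norm]
      calc ‖-(t : ℂ) - z₀‖ = ‖(z - z₀) - (z + t)‖ := by congr 1; ring
        _ ≤ ‖z - z₀‖ + ‖z + t‖ := norm_sub_le _ _
        _ < R := by linarith
    have := hball hmem
    rw [Complex.mem_slitPlane_iff] at this
    simp at this
    linarith
  have hz0 : R / 2 ≤ ‖z‖ := by simpa using key 0 le_rfl
  refine ⟨hzs, hz0, fun t ht => ?_⟩
  have hne : z ≠ 0 := Complex.slitPlane_ne_zero hzs
  have hle : ‖z‖ ≤ ‖z₀‖ + R / 2 := by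
    have := norm_add_le z₀ (z - z₀)
    rw [add_sub_cancel] at this
    linarith
  have : 1 + (t : ℂ) / z = (z + t) / z := by field_simp
  rw [this, norm_div]
  exact div_le_div₀ (norm_nonneg _) (key t ht) (by linarith) hle

theorem norm_cpow_neg_le {w : ℂ} {δ p : ℝ} (hδ : 0 < δ) (hp : 0 ≤ p) (h : δ ≤ ‖w‖) :
    ‖w ^ ((-p : ℝ) : ℂ)‖ ≤ δ ^ (-p) := by
  rw [Complex.norm_cpow_real]
  exact Real.rpow_le_rpow_of_nonpos hδ h (by linarith)

theorem continuousOn_one_add_div_cpow {z : ℂ} (hz : z ∈ Complex.slitPlane) (p : ℂ) :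
    ContinuousOn (fun t : ℝ => (1 + (t : ℂ) / z) ^ p) (Set.Ioi 0) := by
  refine ContinuousOn.cpow_const (by fun_prop) fun t ht => ?_
  exact one_add_div_mem_slitPlane hz (le_of_lt ht)

open MeasureTheory in
theorem integrableOn_gammaWeight_mul_cpow {a b : ℝ} (ha : 0 < a) (hb : 0 < b) {z : ℂ}
    (hz : z ∈ Complex.slitPlane) :
    IntegrableOn (fun t : ℝ => ((Real.exp (-t) * t ^ (b - 1) : ℝ) : ℂ) *
      (1 + (t : ℂ) / z) ^ ((-a : ℝ) : ℂ)) (Set.Ioi 0) volume := by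
  obtain ⟨r, hr, δ, hδ, h⟩ := exists_ball_bounds hz
  obtain ⟨-, -, h⟩ := h z (Metric.mem_ball_self hr)
  refine Integrable.mul_bdd (c := δ ^ (-a)) (integrableOn_gammaWeight hb).ofReal
    ((continuousOn_one_add_div_cpow hz _).aestronglyMeasurable measurableSet_Ioi) ?_
  exact ae_restrict_of_forall_mem measurableSet_Ioi fun t ht =>
    norm_cpow_neg_le hδ ha.le (h t (le_of_lt ht))

open MeasureTheory in
theorem differentiableOn_tricomiN {a b : ℝ} (ha : 0 < a) (hb : 0 < b) :
    DifferentiableOn ℂ (tricomiN a b) Complex.slitPlane := by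
  intro z₀ hz
  obtain ⟨r, hr, δ, hδ, h⟩ := exists_ball_bounds hz
  have hball : Metric.ball z₀ r ∈ nhds z₀ := Metric.ball_mem_nhds _ hr
  have main := hasDerivAt_integral_of_dominated_loc_of_deriv_le
    (μ := volume.restrict (Set.Ioi (0 : ℝ)))
    (F := fun (z : ℂ) (t : ℝ) => ((Real.exp (-t) * t ^ (b - 1) : ℝ) : ℂ) *
      (1 + (t : ℂ) / z) ^ ((-a : ℝ) : ℂ))
    (F' := fun (z : ℂ) (t : ℝ) => ((Real.exp (-t) * t ^ (b - 1) : ℝ) : ℂ) *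
      (((-a : ℝ) : ℂ) * (1 + (t : ℂ) / z) ^ (((-a : ℝ) : ℂ) - 1) * (-(t : ℂ) / z ^ 2)))
    -- Differentiating in `z` produces a factor `t`, which raises the Gamma parameter from `b` to `b
    -- + 1`.
    (bound := fun t => Real.exp (-t) * t ^ ((b + 1) - 1) * (a * δ ^ (-(a + 1)) / r ^ 2))
    hball ?_ (integrableOn_gammaWeight_mul_cpow ha hb hz) ?_ ?_ ?_ ?_
  · exact (main.2.differentiableAt.div_const _).differentiableWithinAt
  · filter_upwards [hball] with z hzb
    exact (integrableOn_gammaWeight_mul_cpow ha hb (h z hzb).1).aestronglyMeasurable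
  · refine (integrableOn_gammaWeight hb).ofReal.aestronglyMeasurable.mul ?_
    refine ContinuousOn.aestronglyMeasurable ?_ measurableSet_Ioi
    refine (continuousOn_const.mul (continuousOn_one_add_div_cpow hz _)).mul ?_
    fun_prop
  · refine ae_restrict_of_forall_mem measurableSet_Ioi fun t ht z hzb => ?_
    obtain ⟨hzs, hzn, hl⟩ := h z hzb
    have ht : 0 < t := ht
    have e1 : ((-a : ℝ) : ℂ) - 1 = ((-(a + 1) : ℝ) : ℂ) := by push_cast; ring
    have e2 : t ^ ((b + 1) - 1) = t ^ (b - 1) * t := by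
      rw [← Real.rpow_add_one ht.ne']; congr 1; ring
    rw [e1, e2, norm_mul, norm_mul, norm_mul, norm_div, norm_neg, norm_pow, Complex.norm_real,
      Complex.norm_real, Complex.norm_real, Real.norm_of_nonneg (by positivity), norm_neg,
      Real.norm_of_nonneg ha.le, Real.norm_of_nonneg ht.le]
    have k1 := norm_cpow_neg_le hδ (by linarith : 0 ≤ a + 1) (hl t ht.le)
    have k2 : t / ‖z‖ ^ 2 ≤ t / r ^ 2 := by gcongr
    calc _ ≤ Real.exp (-t) * t ^ (b - 1) * (a * δ ^ (-(a + 1)) * (t / r ^ 2)) := by gcongr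
      _ = _ := by ring
  · exact (integrableOn_gammaWeight (by linarith)).mul_const _
  · refine ae_restrict_of_forall_mem measurableSet_Ioi fun t ht z hzb => ?_
    have hzs := (h z hzb).1
    have hne := Complex.slitPlane_ne_zero hzs
    have hd : HasDerivAt (fun z : ℂ => 1 + (t : ℂ) / z) (-(t : ℂ) / z ^ 2) z := by
      simpa [div_eq_mul_inv] using ((hasDerivAt_inv hne).const_mul (t : ℂ)).const_add 1
    exact (hd.cpow_const (one_add_div_mem_slitPlane hzs (le_of_lt ht))).const_mul _

/-! ### Symmetry in the two parameters -/

/-- The restriction of `tricomiN` to the positive half-line. -/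
noncomputable def tricomiNReal (a b x : ℝ) : ℝ :=
  (∫ t in Set.Ioi (0 : ℝ), Real.exp (-t) * t ^ (b - 1) * (1 + t / x) ^ (-a)) / Real.Gamma b

theorem tricomiN_ofReal (a b : ℝ) {x : ℝ} (hx : 0 < x) :
    tricomiN a b x = tricomiNReal a b x := by
  rw [tricomiN, tricomiNReal, Complex.ofReal_div, ← integral_complex_ofReal]
  congr 1
  refine MeasureTheory.setIntegral_congr_fun measurableSet_Ioi fun t ht => ?_
  have ht : 0 < t := ht
  have : (0 : ℝ) ≤ 1 + t / x := by positivity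
  simp only [Complex.ofReal_mul, Complex.ofReal_cpow this]
  push_cast
  rfl

open MeasureTheory in
theorem integrableOn_gammaWeight_mul_rpow {a b : ℝ} (ha : 0 < a) (hb : 0 < b) {x : ℝ}
    (hx : 0 < x) :
    IntegrableOn (fun t : ℝ => Real.exp (-t) * t ^ (b - 1) * (1 + t / x) ^ (-a))
      (Set.Ioi 0) volume := by
  refine Integrable.mul_bdd (c := 1) (integrableOn_gammaWeight hb) ?_ ?_
  · refine ContinuousOn.aestronglyMeasurable ?_ measurableSet_Ioi
    refine ContinuousOn.rpow_const (by fun_prop) fun t ht => Or.inl ?_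
    have ht : 0 < t := ht
    positivity
  · refine ae_restrict_of_forall_mem measurableSet_Ioi fun t ht => ?_
    have ht : 0 < t := ht
    have h1 : 1 ≤ 1 + t / x := by have : 0 < t / x := by positivity
                                  linarith
    rw [Real.norm_of_nonneg (by positivity)]
    exact Real.rpow_le_one_of_one_le_of_nonpos h1 (by linarith)

open MeasureTheory in
theorem gammaWeight_integral_swap {a b : ℝ} (ha : 0 < a) (hb : 0 < b) {x : ℝ} (hx : 0 < x) :
    ∫ t in Set.Ioi (0 : ℝ), ∫ s in Set.Ioi (0 : ℝ),
        (Real.exp (-t) * t ^ (b - 1)) * (Real.exp (-s) * s ^ (a - 1)) * Real.exp (-(s * t / x)) =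
      ∫ s in Set.Ioi (0 : ℝ), ∫ t in Set.Ioi (0 : ℝ),
        (Real.exp (-t) * t ^ (b - 1)) * (Real.exp (-s) * s ^ (a - 1)) *
          Real.exp (-(s * t / x)) := by
  refine integral_integral_swap ?_
  refine Integrable.mul_bdd (c := 1)
    (Integrable.mul_prod (integrableOn_gammaWeight hb) (integrableOn_gammaWeight ha))
    (Continuous.aestronglyMeasurable (by fun_prop)) ?_
  rw [Measure.prod_restrict]
  refine ae_restrict_of_forall_mem (measurableSet_Ioi.prod measurableSet_Ioi) fun p hp => ?_
  have h1 : 0 < p.1 := hp.1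
  have h2 : 0 < p.2 := hp.2
  rw [Real.norm_of_nonneg (by positivity), Real.exp_le_one_iff, neg_nonpos]
  positivity

theorem integral_gammaWeight_mul_exp {a t x : ℝ} (ha : 0 < a) (ht : 0 < t) (hx : 0 < x) (k : ℝ) :
    ∫ s in Set.Ioi (0 : ℝ), k * (Real.exp (-s) * s ^ (a - 1)) * Real.exp (-(s * t / x)) =
      k * (1 + t / x) ^ (-a) * Real.Gamma a := by
  have hr : 0 < 1 + t / x := by positivity
  have := Real.integral_rpow_mul_exp_neg_mul_Ioi ha hr
  rw [one_div, Real.inv_rpow hr.le, ← Real.rpow_neg hr.le] at this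
  rw [mul_assoc, ← this, ← MeasureTheory.integral_const_mul]
  refine MeasureTheory.setIntegral_congr_fun measurableSet_Ioi fun s _ => ?_
  have : Real.exp (-((1 + t / x) * s)) = Real.exp (-s) * Real.exp (-(s * t / x)) := by
    rw [← Real.exp_add]; congr 1; ring
  simp only [this]
  ring

/-- Writing `Γ(a) (1 + t/x)^(-a)` as a Laplace integral in `s` gives a double integral with kernel
`exp(-s t / x)`, unchanged when `(a, s)` and `(b, t)` trade places; Fubini concludes. -/
theorem tricomiNReal_symm {a b : ℝ} (ha : 0 < a) (hb : 0 < b) {x : ℝ} (hx : 0 < x) :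
    tricomiNReal a b x = tricomiNReal b a x := by
  have h := gammaWeight_integral_swap ha hb hx
  have h1 : ∀ {a b : ℝ}, 0 < a → ∫ t in Set.Ioi (0 : ℝ), ∫ s in Set.Ioi (0 : ℝ),
      (Real.exp (-t) * t ^ (b - 1)) * (Real.exp (-s) * s ^ (a - 1)) * Real.exp (-(s * t / x)) =
      (∫ t in Set.Ioi (0 : ℝ), Real.exp (-t) * t ^ (b - 1) * (1 + t / x) ^ (-a)) *
        Real.Gamma a := by
    intro a b ha
    rw [← MeasureTheory.integral_mul_const]
    exact MeasureTheory.setIntegral_congr_fun measurableSet_Ioi fun t ht =>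
      integral_gammaWeight_mul_exp ha ht hx _
  have h2 : ∀ s t : ℝ,
      (Real.exp (-t) * t ^ (b - 1)) * (Real.exp (-s) * s ^ (a - 1)) * Real.exp (-(s * t / x)) =
      (Real.exp (-s) * s ^ (a - 1)) * (Real.exp (-t) * t ^ (b - 1)) * Real.exp (-(t * s / x)) := by
    intro s t
    rw [mul_comm s t]; ring
  rw [h1 ha] at h
  simp_rw [h2] at h
  rw [h1 hb] at h
  rw [tricomiNReal, tricomiNReal, div_eq_div_iff (Real.Gamma_pos_of_pos hb).ne'
    (Real.Gamma_pos_of_pos ha).ne', h]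

/-- The identity theorem extends the symmetry from the positive axis, which accumulates at `1`, to
the connected cut plane. -/
theorem tricomiN_symm {a b : ℝ} (ha : 0 < a) (hb : 0 < b) {z : ℂ} (hz : z ∈ Complex.slitPlane) :
    tricomiN a b z = tricomiN b a z := by
  refine ((differentiableOn_tricomiN ha hb).analyticOnNhd
    Complex.isOpen_slitPlane).eqOn_of_preconnected_of_frequently_eq
    ((differentiableOn_tricomiN hb ha).analyticOnNhd Complex.isOpen_slitPlane)
    (Complex.starConvex_one_slitPlane.isPathConnected
      Complex.one_mem_slitPlane).isConnected.isPreconnected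
    Complex.one_mem_slitPlane ?_ hz
  have hlim : Filter.Tendsto (fun x : ℝ => (x : ℂ)) (nhdsWithin 1 {1}ᶜ) (nhdsWithin 1 {1}ᶜ) := by
    refine Filter.Tendsto.inf (Complex.continuous_ofReal.tendsto' 1 1 rfl) ?_
    rw [Filter.tendsto_principal_principal]
    intro x hx
    simpa using hx
  refine hlim.frequently (Filter.Eventually.frequently ?_)
  filter_upwards [nhdsWithin_le_nhds (lt_mem_nhds zero_lt_one)] with x hx
  rw [tricomiN_ofReal _ _ hx, tricomiN_ofReal _ _ hx, tricomiNReal_symm ha hb hx]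

/-! ### Sign of the imaginary part -/

open MeasureTheory in
theorem setIntegral_Ioi_pos {f : ℝ → ℝ} (hf : IntegrableOn f (Set.Ioi 0))
    (hpos : ∀ t, 0 < t → 0 < f t) : 0 < ∫ t in Set.Ioi (0 : ℝ), f t := by
  rw [setIntegral_pos_iff_support_of_nonneg_ae
    (ae_restrict_of_forall_mem measurableSet_Ioi fun t ht => (hpos t ht).le) hf]
  have : Set.Ioi (0 : ℝ) ⊆ Function.support f := fun t ht => (hpos t ht).ne'
  rw [Set.inter_eq_right.2 this]
  simp

/-- With `u = 1 + t/z`, the expression has argument `-(arg z + a * arg u)`. Since `arg u < 0` and `0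
< a < 1`, the bracket is below `arg z < π` and above `arg z + arg u = arg (z + t) ≥ 0`. -/
theorem im_inv_mul_cpow_neg {a : ℝ} (ha : 0 < a) (ha1 : a < 1) {z : ℂ} (hz : 0 < z.im) {t : ℝ}
    (ht : 0 < t) : (z⁻¹ * (1 + (t : ℂ) / z) ^ ((-a : ℝ) : ℂ)).im < 0 := by
  have hz0 : z ≠ 0 := by rintro rfl; simp at hz
  have hn : 0 < Complex.normSq z := Complex.normSq_pos.2 hz0
  have hzs : z ∈ Complex.slitPlane := Complex.mem_slitPlane_iff.2 (Or.inr hz.ne')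
  set u : ℂ := 1 + (t : ℂ) / z with hu
  have hus : u ∈ Complex.slitPlane := one_add_div_mem_slitPlane hzs ht.le
  have hu0 : u ≠ 0 := Complex.slitPlane_ne_zero hus
  have huim : u.im < 0 := by
    rw [hu, div_eq_mul_inv, Complex.add_im, Complex.im_ofReal_mul, Complex.inv_im, Complex.one_im,
      zero_add]
    exact mul_neg_of_pos_of_neg ht (div_neg_of_neg_of_pos (by linarith) hn)
  have hua : u.arg < 0 := Complex.arg_neg_iff.2 huim
  have hul : -Real.pi < u.arg := Complex.neg_pi_lt_arg u
  have hza : 0 ≤ z.arg := Complex.arg_nonneg_iff.2 hz.le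
  have hzl : z.arg < Real.pi := Complex.arg_lt_pi_iff.2 (Or.inr hz.ne')
  have hzu : z * u = z + t := by rw [hu]; field_simp
  have harg : (z * u).arg = z.arg + u.arg :=
    Complex.arg_mul hz0 hu0 ⟨by linarith, by linarith⟩
  have hsum : 0 ≤ z.arg + u.arg := by
    rw [← harg, hzu, Complex.arg_nonneg_iff]
    simpa using hz.le
  have hexp : z⁻¹ * u ^ ((-a : ℝ) : ℂ) =
      Complex.exp (-Complex.log z + Complex.log u * ((-a : ℝ) : ℂ)) := by
    rw [Complex.exp_add, Complex.exp_neg, Complex.exp_log hz0, Complex.cpow_def_of_ne_zero hu0]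
  rw [hexp, Complex.exp_im, Complex.add_im, Complex.neg_im, Complex.im_mul_ofReal, Complex.log_im,
    Complex.log_im]
  refine mul_neg_of_pos_of_neg (Real.exp_pos _) (Real.sin_neg_of_neg_of_neg_pi_lt ?_ ?_)
  · nlinarith
  · nlinarith

open MeasureTheory in
theorem inv_mul_tricomiN_im_neg {a b : ℝ} (ha : 0 < a) (ha1 : a < 1) (hb : 0 < b) {z : ℂ}
    (hz : 0 < z.im) : (z⁻¹ * tricomiN a b z).im < 0 := by
  have hzs : z ∈ Complex.slitPlane := Complex.mem_slitPlane_iff.2 (Or.inr hz.ne')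
  have hint := (integrableOn_gammaWeight_mul_cpow ha hb hzs).const_mul z⁻¹
  have hG := Real.Gamma_pos_of_pos hb
  rw [tricomiN, mul_div_assoc', Complex.div_ofReal_im, ← integral_const_mul]
  refine div_neg_of_neg_of_pos ?_ hG
  have him := integral_im hint
  simp only [RCLike.im_to_complex] at him
  rw [← him, ← neg_pos, ← integral_neg]
  refine setIntegral_Ioi_pos hint.im.neg fun t ht => ?_
  rw [mul_left_comm, Complex.im_ofReal_mul, ← mul_neg]
  have := im_inv_mul_cpow_neg ha ha1 hz ht
  exact mul_pos (by positivity) (by linarith)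

theorem tricomiN_conj (a b : ℝ) {z : ℂ} (hz : z ∈ Complex.slitPlane) :
    tricomiN a b (starRingEnd ℂ z) = starRingEnd ℂ (tricomiN a b z) := by
  rw [tricomiN, tricomiN, map_div₀, Complex.conj_ofReal, ← integral_conj]
  congr 1
  refine MeasureTheory.setIntegral_congr_fun measurableSet_Ioi fun t ht => ?_
  have harg := (Complex.mem_slitPlane_iff_arg.1 (one_add_div_mem_slitPlane hz (le_of_lt ht))).1
  simp only [map_mul, Complex.conj_ofReal]
  rw [← Complex.conj_ofReal (-a), ← Complex.conj_cpow _ _ harg]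
  simp

theorem inv_mul_tricomiN_im_pos {a b : ℝ} (ha : 0 < a) (ha1 : a < 1) (hb : 0 < b) {z : ℂ}
    (hz : z.im < 0) : 0 < (z⁻¹ * tricomiN a b z).im := by
  have hzs : z ∈ Complex.slitPlane := Complex.mem_slitPlane_iff.2 (Or.inr hz.ne)
  have := inv_mul_tricomiN_im_neg ha ha1 hb (z := starRingEnd ℂ z) (by simpa using hz)
  rw [tricomiN_conj a b hzs, ← map_inv₀, ← map_mul, Complex.conj_im] at this
  linarith

/-! ### Behaviour on the positive half-line -/

theorem inv_mul_one_add_div_rpow (a : ℝ) {x t : ℝ} (hx : 0 < x) (ht : 0 < t) :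
    x⁻¹ * (1 + t / x) ^ (-a) = x ^ (a - 1) * (x + t) ^ (-a) := by
  have h1 : 1 + t / x = (x + t) * x⁻¹ := by field_simp
  rw [h1, Real.rpow_sub_one hx.ne', Real.mul_rpow (by positivity) (by positivity),
    Real.inv_rpow hx.le, ← Real.rpow_neg hx.le, neg_neg]
  ring

/-- The real Stieltjes function `x⁻¹ * tricomiNReal a b x`, as one integral. -/
theorem inv_mul_tricomiNReal_eq (a b : ℝ) {x : ℝ} (hx : 0 < x) :
    x⁻¹ * tricomiNReal a b x = (∫ t in Set.Ioi (0 : ℝ),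
      Real.exp (-t) * t ^ (b - 1) * (x ^ (a - 1) * (x + t) ^ (-a))) / Real.Gamma b := by
  rw [tricomiNReal, mul_div_assoc', ← MeasureTheory.integral_const_mul]
  congr 1
  refine MeasureTheory.setIntegral_congr_fun measurableSet_Ioi fun t ht => ?_
  simp only [← inv_mul_one_add_div_rpow a hx ht]
  ring

theorem integrableOn_stieltjes {a b : ℝ} (ha : 0 < a) (hb : 0 < b) {x : ℝ} (hx : 0 < x) :
    MeasureTheory.IntegrableOn (fun t : ℝ =>
      Real.exp (-t) * t ^ (b - 1) * (x ^ (a - 1) * (x + t) ^ (-a))) (Set.Ioi 0) := by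
  refine MeasureTheory.IntegrableOn.congr_fun
    ((integrableOn_gammaWeight_mul_rpow ha hb hx).const_mul x⁻¹) (fun t ht => ?_) measurableSet_Ioi
  simp only [← inv_mul_one_add_div_rpow a hx ht]
  ring

open MeasureTheory in
theorem tricomiNReal_pos {a b : ℝ} (ha : 0 < a) (hb : 0 < b) {x : ℝ} (hx : 0 < x) :
    0 < tricomiNReal a b x := by
  exact div_pos (setIntegral_Ioi_pos (integrableOn_gammaWeight_mul_rpow ha hb hx)
    fun t ht => by positivity) (Real.Gamma_pos_of_pos hb)

-- Both factors of `x^(a-1) * (x+t)^(-a)` decrease in `x`; the first needs `a < 1`.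
open MeasureTheory in
theorem inv_mul_tricomiNReal_strictAntiOn {a b : ℝ} (ha : 0 < a) (ha1 : a < 1) (hb : 0 < b) :
    StrictAntiOn (fun x => x⁻¹ * tricomiNReal a b x) (Set.Ioi 0) := by
  intro x hx y hy hxy
  have hx : 0 < x := hx
  have hy : 0 < y := hy
  simp only [inv_mul_tricomiNReal_eq a b hx, inv_mul_tricomiNReal_eq a b hy]
  refine div_lt_div_of_pos_right ?_ (Real.Gamma_pos_of_pos hb)
  have hix := integrableOn_stieltjes ha hb hx
  have hiy := integrableOn_stieltjes ha hb hy
  rw [← sub_pos, ← integral_sub hix hiy]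
  refine setIntegral_Ioi_pos (hix.sub hiy) fun t ht => ?_
  rw [← mul_sub]
  have k1 : y ^ (a - 1) < x ^ (a - 1) := Real.rpow_lt_rpow_of_neg hx hxy (by linarith)
  have k2 : (y + t) ^ (-a) < (x + t) ^ (-a) :=
    Real.rpow_lt_rpow_of_neg (by linarith) (by linarith) (by linarith)
  exact mul_pos (by positivity) (sub_pos.2 (mul_lt_mul'' k1 k2 (by positivity) (by positivity)))

theorem tricomiNReal_le_one {a b : ℝ} (ha : 0 < a) (hb : 0 < b) {x : ℝ} (hx : 0 < x) :
    tricomiNReal a b x ≤ 1 := by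
  rw [tricomiNReal, div_le_one (Real.Gamma_pos_of_pos hb), Real.Gamma_eq_integral hb]
  refine MeasureTheory.setIntegral_mono_on (integrableOn_gammaWeight_mul_rpow ha hb hx)
    (integrableOn_gammaWeight hb) measurableSet_Ioi fun t ht => ?_
  have ht : 0 < t := ht
  have h1 : 1 ≤ 1 + t / x := by
    have : 0 < t / x := by positivity
    linarith
  exact mul_le_of_le_one_right (by positivity)
    (Real.rpow_le_one_of_one_le_of_nonpos h1 (by linarith))

/-- This forces blow-up at `0` when `a < 1`; it holds because `x + t ≤ 1 + t`. -/
theorem le_inv_mul_tricomiNReal {a b : ℝ} (ha : 0 < a) (hb : 0 < b) {x : ℝ}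
    (hx : 0 < x) (hx1 : x ≤ 1) :
    x ^ (a - 1) * tricomiNReal a b 1 ≤ x⁻¹ * tricomiNReal a b x := by
  rw [inv_mul_tricomiNReal_eq a b hx, tricomiNReal, mul_div_assoc',
    ← MeasureTheory.integral_const_mul]
  refine div_le_div_of_nonneg_right ?_ (Real.Gamma_pos_of_pos hb).le
  refine MeasureTheory.setIntegral_mono_on
    ((integrableOn_gammaWeight_mul_rpow ha hb one_pos).const_mul _)
    (integrableOn_stieltjes ha hb hx) measurableSet_Ioi fun t ht => ?_
  have ht : 0 < t := ht
  have : (1 + t / 1) ^ (-a) ≤ (x + t) ^ (-a) :=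
    Real.rpow_le_rpow_of_nonpos (by linarith) (by linarith) (by linarith)
  calc _ = Real.exp (-t) * t ^ (b - 1) * (x ^ (a - 1) * (1 + t / 1) ^ (-a)) := by ring
    _ ≤ _ := by gcongr

theorem continuousOn_tricomiNReal {a b : ℝ} (ha : 0 < a) (hb : 0 < b) :
    ContinuousOn (tricomiNReal a b) (Set.Ioi 0) := by
  have h : ContinuousOn (fun x : ℝ => (tricomiN a b x).re) (Set.Ioi 0) :=
    Complex.continuous_re.comp_continuousOn
      ((differentiableOn_tricomiN ha hb).continuousOn.comp Complex.continuous_ofReal.continuousOn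
        fun x hx => Complex.ofReal_mem_slitPlane.2 hx)
  exact h.congr fun x hx => by simp only [tricomiN_ofReal a b hx, Complex.ofReal_re]

theorem exists_inv_mul_tricomiNReal_eq {a b p q : ℝ} (ha : 0 < a) (ha1 : a < 1) (hb : 0 < b)
    (hp : 0 ≤ p) (hpq : 0 < p ∨ (p = 0 ∧ 0 < q)) :
    ∃ x : ℝ, 0 < x ∧ x⁻¹ * tricomiNReal a b x = p * x + q := by
  have hN := tricomiNReal_pos ha hb one_pos
  have hsmall : ∀ᶠ x : ℝ in nhdsWithin 0 (Set.Ioi 0),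
      p * x + q ≤ x⁻¹ * tricomiNReal a b x := by
    have h1 : Filter.Tendsto (fun x : ℝ => x ^ (a - 1) * tricomiNReal a b 1)
        (nhdsWithin 0 (Set.Ioi 0)) Filter.atTop :=
      (tendsto_rpow_neg_nhdsGT_zero (by linarith)).atTop_mul_const hN
    filter_upwards [h1.eventually_ge_atTop (p + q), Ioc_mem_nhdsGT one_pos] with x hx h01
    have := le_inv_mul_tricomiNReal ha hb h01.1 h01.2
    have : p * x ≤ p * 1 := mul_le_mul_of_nonneg_left h01.2 hp
    linarith
  obtain ⟨x₁, hx₁, hx₁0⟩ := (hsmall.and self_mem_nhdsWithin).exists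
  have hlarge : ∀ᶠ x : ℝ in Filter.atTop, x⁻¹ * tricomiNReal a b x ≤ p * x + q := by
    have hpt : ∃ ε > 0, ∀ᶠ x : ℝ in Filter.atTop, ε ≤ p * x + q := by
      rcases hpq with h | ⟨rfl, h⟩
      · exact ⟨1, one_pos, (Filter.tendsto_atTop_add_const_right _ q
          (Filter.tendsto_id.const_mul_atTop h)).eventually_ge_atTop 1⟩
      · exact ⟨q, h, by simp⟩
    obtain ⟨ε, hε, hev⟩ := hpt
    filter_upwards [hev, Filter.eventually_gt_atTop 0,
      tendsto_inv_atTop_zero.eventually_le_const hε] with x h1 h2 h3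
    refine le_trans ?_ (h3.trans h1)
    exact mul_le_of_le_one_right (by positivity) (tricomiNReal_le_one ha hb h2)
  obtain ⟨x₂, hx₂, hx₂0⟩ := (hlarge.and (Filter.eventually_gt_atTop 0)).exists
  have hcont : ContinuousOn (fun x => x⁻¹ * tricomiNReal a b x) (Set.Ioi 0) :=
    (continuousOn_id.inv₀ fun x (hx : 0 < x) => hx.ne').mul (continuousOn_tricomiNReal ha hb)
  obtain ⟨x, hx, he⟩ := isPreconnected_Ioi.intermediate_value₂ hx₁0 hx₂0
    (f := fun x => p * x + q) (by fun_prop) hcont hx₁ hx₂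
  exact ⟨x, hx, he.symm⟩

/-! ### Solutions are real, and the return to the Whittaker function -/

/-- Where `z⁻¹ * tricomiN a b z` meets the line `p * z + q`, the point `z` is real. -/
theorem im_eq_zero_of_inv_mul_tricomiN_eq {a b p q : ℝ} (ha : 0 < a) (ha1 : a < 1) (hb : 0 < b)
    (hp : 0 ≤ p) {z : ℂ} (h : z⁻¹ * tricomiN a b z = p * z + q) : z.im = 0 := by
  have him := congrArg Complex.im h
  rw [Complex.add_im, Complex.im_ofReal_mul, Complex.ofReal_im, add_zero] at him
  rcases lt_trichotomy z.im 0 with hz | hz | hz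
  · have := inv_mul_tricomiN_im_pos ha ha1 hb hz
    nlinarith
  · exact hz
  · have := inv_mul_tricomiN_im_neg ha ha1 hb hz
    nlinarith

theorem exists_ofReal_of_inv_mul_tricomiN_eq {a b p q : ℝ} (ha : 0 < a) (ha1 : a < 1) (hb : 0 < b)
    (hp : 0 ≤ p) {z : ℂ} (hz : z ∈ Complex.slitPlane) (h : z⁻¹ * tricomiN a b z = p * z + q) :
    ∃ x : ℝ, 0 < x ∧ (x : ℂ) = z ∧ x⁻¹ * tricomiNReal a b x = p * x + q := by
  have him := im_eq_zero_of_inv_mul_tricomiN_eq ha ha1 hb hp h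
  obtain ⟨x, rfl⟩ : ∃ x : ℝ, (x : ℂ) = z := ⟨z.re, Complex.ext (by simp) (by simp [him])⟩
  have hx := Complex.ofReal_mem_slitPlane.1 hz
  refine ⟨x, hx, rfl, ?_⟩
  rw [tricomiN_ofReal a b hx] at h
  exact_mod_cast h

theorem whittakerW_eq_tricomiN (α β : ℝ) (z : ℂ) :
    whittakerW (-((α : ℂ) + (β : ℂ)) / 2) (((β : ℂ) - (α : ℂ)) / 2) z =
      Complex.exp (-z / 2) * z ^ (-((α : ℂ) + (β : ℂ)) / 2) *
        tricomiN (α + 1 / 2) (β + 1 / 2) z := by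
  have e1 : (1 / 2 + ((β : ℂ) - α) / 2 - -((α : ℂ) + β) / 2) = ((β + 1 / 2 : ℝ) : ℂ) := by
    push_cast; ring
  have e2 : (((β : ℂ) - α) / 2 - -((α : ℂ) + β) / 2 - 1 / 2) = ((β + 1 / 2 - 1 : ℝ) : ℂ) := by
    push_cast; ring
  have e3 : (((β : ℂ) - α) / 2 + -((α : ℂ) + β) / 2 - 1 / 2) = ((-(α + 1 / 2) : ℝ) : ℂ) := by
    push_cast; ring
  rw [whittakerW, e1, e2, e3, Complex.Gamma_ofReal, tricomiN, div_mul_eq_mul_div, mul_div_assoc]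
  congr 2
  refine MeasureTheory.setIntegral_congr_fun measurableSet_Ioi fun t ht => ?_
  simp only [Complex.ofReal_mul, Complex.ofReal_exp, Complex.ofReal_neg,
    Complex.ofReal_cpow (le_of_lt ht)]

theorem cpow_mul_exp_mul_whittakerW (α β : ℝ) {z : ℂ} (hz : z ≠ 0) :
    z ^ (((α : ℂ) + (β : ℂ)) / 2 - 1) * Complex.exp (z / 2) *
        whittakerW (-((α : ℂ) + (β : ℂ)) / 2) (((β : ℂ) - (α : ℂ)) / 2) z =
      z⁻¹ * tricomiN (α + 1 / 2) (β + 1 / 2) z := by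
  have h1 : Complex.exp (z / 2) * Complex.exp (-z / 2) = 1 := by
    rw [← Complex.exp_add]; ring_nf; simp
  have h2 : z ^ (((α : ℂ) + (β : ℂ)) / 2 - 1) * z ^ (-((α : ℂ) + (β : ℂ)) / 2) = z⁻¹ := by
    rw [← Complex.cpow_add _ _ hz, ← Complex.cpow_neg_one]; ring_nf
  rw [whittakerW_eq_tricomiN, ← h2]
  linear_combination (z ^ (((α : ℂ) + (β : ℂ)) / 2 - 1) * z ^ (-((α : ℂ) + (β : ℂ)) / 2) *
    tricomiN (α + 1 / 2) (β + 1 / 2) z) * h1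

theorem whittakerSolutions_eq {α β a b p q : ℝ}
    (heq : ∀ z ∈ Complex.slitPlane, tricomiN (α + 1 / 2) (β + 1 / 2) z = tricomiN a b z) :
    whittakerSolutions α β p q =
      {z : ℂ | z ∈ Complex.slitPlane ∧ z⁻¹ * tricomiN a b z = p * z + q} := by
  ext z
  refine and_congr_right fun hz => ?_
  rw [cpow_mul_exp_mul_whittakerW α β (Complex.slitPlane_ne_zero hz), heq z hz, sub_sub, sub_eq_zero]

theorem whittaker_equation_of_tricomiN_eq {α β a b p q : ℝ} (ha : 0 < a) (ha1 : a < 1)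
    (hb : 0 < b) (hp : 0 ≤ p)
    (heq : ∀ z ∈ Complex.slitPlane, tricomiN (α + 1 / 2) (β + 1 / 2) z = tricomiN a b z) :
    ((0 < p ∨ (p = 0 ∧ 0 < q)) → ∃ x : ℝ, 0 < x ∧ whittakerSolutions α β p q = {(x : ℂ)}) ∧
    (¬ (0 < p ∨ (p = 0 ∧ 0 < q)) → whittakerSolutions α β p q = ∅) ∧
    (∀ z ∈ Complex.slitPlane,
      whittakerW (-((α : ℂ) + (β : ℂ)) / 2) (((β : ℂ) - (α : ℂ)) / 2) z ≠ 0) := by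
  rw [whittakerSolutions_eq heq]
  refine ⟨fun h => ?_, fun h => ?_, fun z hz h0 => ?_⟩
  · obtain ⟨x, hx, he⟩ := exists_inv_mul_tricomiNReal_eq ha ha1 hb hp h
    refine ⟨x, hx, Set.eq_singleton_iff_unique_mem.2 ⟨⟨Complex.ofReal_mem_slitPlane.2 hx, ?_⟩, ?_⟩⟩
    · rw [tricomiN_ofReal a b hx]
      exact_mod_cast he
    · rintro z ⟨hz, hzeq⟩
      obtain ⟨y, hy, rfl, hye⟩ := exists_ofReal_of_inv_mul_tricomiN_eq ha ha1 hb hp hz hzeq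
      have hanti := inv_mul_tricomiNReal_strictAntiOn ha ha1 hb
      rcases lt_trichotomy x y with hxy | rfl | hxy
      · have h1 := hanti hx hy hxy
        simp only [he, hye] at h1
        nlinarith
      · rfl
      · have h1 := hanti hy hx hxy
        simp only [he, hye] at h1
        nlinarith
  · refine Set.eq_empty_iff_forall_notMem.2 fun z ⟨hz, hzeq⟩ => ?_
    obtain ⟨y, hy, rfl, hye⟩ := exists_ofReal_of_inv_mul_tricomiN_eq ha ha1 hb hp hz hzeq
    push Not at h
    have hp0 : p = 0 := le_antisymm h.1 hp
    have hq := h.2 hp0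
    have := mul_pos (inv_pos.2 hy) (tricomiNReal_pos ha hb hy)
    rw [hye, hp0] at this
    linarith
  · rw [whittakerW_eq_tricomiN, heq z hz] at h0
    have hz0 := Complex.slitPlane_ne_zero hz
    have hN : tricomiN a b z = 0 := by
      simpa [Complex.exp_ne_zero, Complex.cpow_eq_zero_iff, hz0] using h0
    -- A zero solves the equation with zero right-hand side, so it would give a positive real zero,
    -- where the integrand is positive.
    obtain ⟨y, hy, -, hye⟩ := exists_ofReal_of_inv_mul_tricomiN_eq (p := 0) (q := 0) ha ha1 hb
      le_rfl hz (by simp [hN])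
    have := mul_pos (inv_pos.2 hy) (tricomiNReal_pos ha hb hy)
    simp [hye] at this

theorem mainTheorem8 (α β b c : ℝ)
    (hαβ : (-1 / 2 < α ∧ -1 / 2 < β ∧ β < 1 / 2) ∨ (-1 / 2 < β ∧ -1 / 2 < α ∧ α < 1 / 2))
    (hb : 0 ≤ b) :
    ((0 < b ∨ (b = 0 ∧ 0 < c)) → ∃ x : ℝ, 0 < x ∧ whittakerSolutions α β b c = {(x : ℂ)}) ∧
    (¬ (0 < b ∨ (b = 0 ∧ 0 < c)) → whittakerSolutions α β b c = ∅) ∧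
    (∀ z ∈ Complex.slitPlane,
      whittakerW (-((α : ℂ) + (β : ℂ)) / 2) (((β : ℂ) - (α : ℂ)) / 2) z ≠ 0) := by
  rcases hαβ with ⟨h1, h2, h3⟩ | ⟨h1, h2, h3⟩
  -- The exponent parameter must be the one in `(0, 1)`, here `β + 1 / 2`, so the roles are
  -- exchanged by symmetry.
  · exact whittaker_equation_of_tricomiN_eq (a := β + 1 / 2) (b := α + 1 / 2) (by linarith)
      (by linarith) (by linarith) hb
      fun z hz => tricomiN_symm (by linarith) (by linarith) hz
  · exact whittaker_equation_of_tricomiN_eq (a := α + 1 / 2) (b := β + 1 / 2) (by linarith)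
      (by linarith) (by linarith) hb fun z _ => rfl
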